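/- For a domain $D\subset\mathbb C^n$, $z,w\in D$ and $X\in\mathbb C^n$, let $$g_D(z,w)=\sup\{u(w):u\in\mathrm{PSH}(D),\ u<0,\ u\le\log\|\cdot-z\|+C\text{ on }D\text{ for some }C\in\mathbb R\}$$ be the pluricomplex Green function, $$A_D(z;X)=\limsup_{\lambda\to0,\ \lambda\ne 0}\frac{\exp g_D(z,z+\lambda X)}{|\lambda|}$$ the Azukawa metric, and $$S_D(z;X)=\sup_v\,[\mathcal L_v(z;X)]^{1/2}$$ the Sibony metric, where $\mathcal L_v(z;X)=\sum_{j,k}\frac{\partial^2 v}{\partial z_j\partial\bar z_k}(z)X_j\overline{X_k}$ is the Levi form and $v$ runs over all functions $v:D\to[0,1)$ such that $v(z)=0$, $\log v$ is plurisubharmonic on $D$ and $v$ is of class $C^2$ near $z$. For $M\in\{A,S\}$ let $V^M_D(z)\in[0,\infty]$ be the Lebesgue measure of the indicatrix $\{X\in\mathbb C^n:M_D(z;X)<1\}$. Let $D=\{z\in\mathbb C^2:1<|z_1|+|z_2|<2\}$. Then: 1. $D$ is a bounded domain which has Lipschitz boundary near each of its boundary points, and $(1,0)\in\partial D$. (Lipschitz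 boundary near $p\in\partial D$ means that, after an isometric real-linear change of coordinates of $\mathbb C^n=\mathbb R^{2n}$, $D$ coincides near $p$ with the region $\{t<f(y)\}$, $(t,y)\in\mathbb R\times\mathbb R^{2n-1}$, for a real-valued Lipschitz function $f$.) 2. There are constants $C<\infty$ and $\delta>0$ such that $A_D((x,0);X)\le C$ for all $x\in(1,1+\delta)$ and all $X\in\mathbb C^2$ with $\|X\|=1$; that is, $\limsup_{x\to1^+}A_D((x,0);X)<\infty$ uniformly in the unit vectors $X$. 3. In particular, $\liminf_{x\to1^+}V^A_D((x,0))>0$. 4. Hence neither $V^A_D(z)$ nor $V^S_D(z)$ tends to $0$ as $z\to(1,0)$, $z\in D$. So the assertion "if $D$ is a bounded domain in $\mathbb C^n$ with $C^1$ boundary near $p\in\partial D$, then $\lim_{z\to p}V^S_D(z)=0$" becomes false, even for $V^A_D$, when $C^1$ is replaced by Lipschitz. -/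

import Mathlib

open Filter Topology MeasureTheory
open scoped ENNReal NNReal

noncomputable section

/-- `ℂⁿ` with its Euclidean norm and Lebesgue measure. -/
abbrev Cn (n : ℕ) := EuclideanSpace ℂ (Fin n)

/-- The logarithm of a nonnegative real number, with `log 0 = -∞`. -/
def elog (t : ℝ) : EReal := ENNReal.log (ENNReal.ofReal t)

/-- The mean value of `u` over the circle `{a + e^{iθ} b}`, as the mean of the positive part
minus the mean of the negative part. For `u < +∞` upper semicontinuous on the circle, `u` is
measurable and bounded above there, so this is the usual mean, with value in `[-∞, +∞)`. -/
def circleMean {n : ℕ} (u : Cn n → EReal) (a b : Cn n) : EReal :=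
  ((⨍⁻ θ : ℝ, (u (a + Complex.exp (θ * Complex.I) • b)).toENNReal
      ∂(volume.restrict (Set.Ioc 0 (2 * Real.pi))) : ℝ≥0∞) : EReal)
    - ((⨍⁻ θ : ℝ, (-u (a + Complex.exp (θ * Complex.I) • b)).toENNReal
      ∂(volume.restrict (Set.Ioc 0 (2 * Real.pi))) : ℝ≥0∞) : EReal)

/-- `u` is plurisubharmonic on the open set `D`: it takes values in `[-∞, +∞)`, is upper
semicontinuous, and satisfies the sub-mean value inequality on every closed affine complex disc
contained in `D`. (The constant `-∞` is allowed.) Values of `u` outside `D` play no role. -/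
structure IsPSH {n : ℕ} (D : Set (Cn n)) (u : Cn n → EReal) : Prop where
  lt_top : ∀ w ∈ D, u w < ⊤
  usc : UpperSemicontinuousOn u D
  le_circleMean : ∀ a b : Cn n, (∀ t : ℂ, ‖t‖ ≤ 1 → a + t • b ∈ D) → u a ≤ circleMean u a b

/-- The negative plurisubharmonic functions on `D` with a logarithmic pole at `z`. The bound is
non-strict because both of its sides are `-∞` at `w = z`. -/
def greenClass {n : ℕ} (D : Set (Cn n)) (z : Cn n) : Set (Cn n → EReal) :=
  {u | IsPSH D u ∧ (∀ w ∈ D, u w < 0) ∧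
    ∃ C : ℝ, ∀ w ∈ D, u w ≤ elog ‖w - z‖ + (C : EReal)}

/-- The pluricomplex Green function of `D` with pole at `z`. -/
def pluricomplexGreen {n : ℕ} (D : Set (Cn n)) (z w : Cn n) : EReal :=
  ⨆ u ∈ greenClass D z, u w

/-- The Azukawa metric `A_D(z; X)`. -/
def azukawa {n : ℕ} (D : Set (Cn n)) (z X : Cn n) : ℝ≥0∞ :=
  limsup (fun t : ℂ => EReal.exp (pluricomplexGreen D z (z + t • X)) / ENNReal.ofReal ‖t‖)
    (𝓝[≠] 0)

/-- The Wirtinger derivative `∂f/∂z_j = (∂f/∂x_j - i ∂f/∂y_j) / 2`. -/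
def wirtinger {n : ℕ} (j : Fin n) (f : Cn n → ℂ) (w : Cn n) : ℂ :=
  (1 / 2) * (fderiv ℝ f w (EuclideanSpace.single j 1)
    - Complex.I * fderiv ℝ f w (EuclideanSpace.single j Complex.I))

/-- The Wirtinger derivative `∂f/∂z̄_j = (∂f/∂x_j + i ∂f/∂y_j) / 2`. -/
def wirtingerBar {n : ℕ} (j : Fin n) (f : Cn n → ℂ) (w : Cn n) : ℂ :=
  (1 / 2) * (fderiv ℝ f w (EuclideanSpace.single j 1)
    + Complex.I * fderiv ℝ f w (EuclideanSpace.single j Complex.I))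

/-- The Levi form `∑ j k, ∂²v/∂z_j∂z̄_k (z) X_j conj(X_k)` of a real function `v` (the sum is
real where `v` is of class `C²`). -/
def leviForm {n : ℕ} (v : Cn n → ℝ) (z X : Cn n) : ℝ :=
  (∑ j : Fin n, ∑ k : Fin n,
    wirtinger j (wirtingerBar k (fun w => (v w : ℂ))) z * X j * (starRingEnd ℂ) (X k)).re

/-- The functions `v : D → [0, 1)` with `v z = 0` and `log v` plurisubharmonic on `D` that are of
class `C²` near `z`. -/
def sibonyClass {n : ℕ} (D : Set (Cn n)) (z : Cn n) : Set (Cn n → ℝ) :=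
  {v | (∀ w ∈ D, 0 ≤ v w ∧ v w < 1) ∧ v z = 0 ∧ IsPSH D (fun w => elog (v w)) ∧
    ContDiffAt ℝ 2 v z}

/-- The Sibony metric `S_D(z; X)`. -/
def sibony {n : ℕ} (D : Set (Cn n)) (z X : Cn n) : ℝ≥0∞ :=
  ⨆ v ∈ sibonyClass D z, ENNReal.ofReal (Real.sqrt (leviForm v z X))

/-- The volume of the indicatrix of the Azukawa metric at `z`. -/
def volAzukawa {n : ℕ} (D : Set (Cn n)) (z : Cn n) : ℝ≥0∞ :=
  volume {X : Cn n | azukawa D z X < 1}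

/-- The volume of the indicatrix of the Sibony metric at `z`. -/
def volSibony {n : ℕ} (D : Set (Cn n)) (z : Cn n) : ℝ≥0∞ :=
  volume {X : Cn n | sibony D z X < 1}

/-- `D` has Lipschitz boundary near `p`: for some real direction `e`, near `p` the set `D` is the
region strictly below the graph, in the direction `e`, of a Lipschitz function of the orthogonal
projection onto the real hyperplane orthogonal to `e`. -/
def LipschitzBoundaryNear {n : ℕ} (D : Set (Cn n)) (p : Cn n) : Prop :=
  ∃ e : Cn n, ‖e‖ = 1 ∧ ∃ (K : ℝ≥0) (f : Cn n → ℝ), LipschitzWith K f ∧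
    ∀ᶠ w in 𝓝 p, (w ∈ D ↔ inner ℝ e w < f (w - (inner ℝ e w) • e))

/-- The domain `{1 < |z₁| + |z₂| < 2}` in `ℂ²`. -/
def shellDomain : Set (Cn 2) := {z | 1 < ‖z 0‖ + ‖z 1‖ ∧ ‖z 0‖ + ‖z 1‖ < 2}

/-- The point `(x, 0)` of `ℂ²`. -/
def axisPoint (x : ℝ) : Cn 2 := !₂[(x : ℂ), 0]

end

/-!
The point `(1, 0)` is an inner boundary point, but discs through `(x, 0)` with `x > 1` are trapped
in the shell as soon as their direction `Y` satisfies `|Y₀| ≤ |Y₁|`, because then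
`|x + s Y₀| + |s Y₁| ≥ x`. Their radius is about `(2 - x) / ‖Y‖`, which does not shrink as
`x → 1⁺`. On such a disc of radius `R` the Schwarz lemma bounds a nonpositive plurisubharmonic
function with a logarithmic pole of order `m` at the centre by `m log (|s| / R)`. Every other
direction `X` is the centre of a circle of trapped ones `X + w e`, `|w| = 1`, and the maximum
principle in `w` carries the bound over to `X` near the pole. Order one gives the bound `1 / R` for
the Azukawa metric. For the Sibony metric, `log v` has a pole of order two, so `v ≤ (|s| / R)²`
along `X`, and the second derivative test gives the same bound.

For the Lipschitz boundary, a norm `N` grows at a definite rate in the direction of a point `p`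
only near `p`; it is replaced by the infimum over `t ≥ 0` of `N (w + t p) - t N p / 2`, which grows
in that direction everywhere and agrees with `N` near `p`.
-/

open Metric InnerProductSpace
open scoped ComplexConjugate

/-! ### Subharmonic functions of one complex variable -/

/-- Subharmonicity on a set `S`, which need not be open: `φ` takes values in `[-∞, +∞)`, is upper
semicontinuous, and on every closed disc contained in `S` it is bounded at the centre by every
harmonic function that dominates it on the bounding circle. -/
structure IsSubharmonicOn (φ : ℂ → EReal) (S : Set ℂ) : Prop where
  lt_top : ∀ t ∈ S, φ t < ⊤
  usc : UpperSemicontinuousOn φ S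
  le_of_le_harmonic : ∀ ⦃h : ℂ → ℝ⦄ ⦃c : ℂ⦄ ⦃r : ℝ⦄, 0 ≤ r → closedBall c r ⊆ S →
    HarmonicOnNhd h (closedBall c r) → (∀ t ∈ sphere c r, φ t ≤ h t) → φ c ≤ h c

theorem norm_sq_eq_re_of_mem_sphere {c t : ℂ} {r : ℝ} (ht : t ∈ sphere c r) :
    ‖t‖ ^ 2 = (2 * conj c * t).re - ‖c‖ ^ 2 + r ^ 2 := by
  rw [← mem_sphere_iff_norm.1 ht]
  simp only [← Complex.normSq_eq_norm_sq, Complex.normSq_apply, Complex.mul_re, Complex.mul_im,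
    Complex.sub_re, Complex.sub_im, Complex.conj_re, Complex.conj_im, Complex.re_ofNat,
    Complex.im_ofNat]
  ring

theorem exists_add_const_touching {X : Type*} [TopologicalSpace X] {K : Set X} {φ : X → EReal}
    {g : X → ℝ} (hK : IsCompact K) (hφ : UpperSemicontinuousOn φ K) (htop : ∀ t ∈ K, φ t < ⊤)
    (hg : ContinuousOn g K) :
    (∀ t ∈ K, φ t = ⊥) ∨ ∃ a : ℝ, ∃ c ∈ K, φ c = ↑(g c + a) ∧ ∀ t ∈ K, φ t ≤ ↑(g t + a) := by
  rcases K.eq_empty_or_nonempty with rfl | hne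
  · exact .inl (by simp)
  have husc : UpperSemicontinuousOn (fun t => φ t + ((-g t : ℝ) : EReal)) K :=
    hφ.add' (continuous_coe_real_ereal.comp_continuousOn hg.neg).upperSemicontinuousOn
      fun _ _ => EReal.continuousAt_add (.inr (EReal.coe_ne_bot _)) (.inr (EReal.coe_ne_top _))
  obtain ⟨c, hcK, hmax⟩ := husc.exists_isMaxOn hne hK
  have hle : ∀ t ∈ K, φ t - g t ≤ φ c - g c := fun t ht => hmax ht
  have hle' : ∀ t ∈ K, φ t ≤ φ c - g c + g t := fun t ht =>
    (EReal.sub_le_iff_le_add (.inl (EReal.coe_ne_bot _)) (.inl (EReal.coe_ne_top _))).1 (hle t ht)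
  rcases eq_or_ne (φ c) ⊥ with hbot | hbot
  · exact .inl fun t ht => by simpa [hbot] using hle' t ht
  lift φ c to ℝ using ⟨(htop c hcK).ne, hbot⟩ with U hU
  refine .inr ⟨U - g c, c, hcK, ?_, fun t ht => ?_⟩
  · rw [← hU, add_sub_cancel]
  · rw [add_comm]
    exact_mod_cast hle' t ht

namespace IsSubharmonicOn

variable {φ : ℂ → EReal} {h : ℂ → ℝ} {S T K : Set ℂ} {c : ℂ} {r ε : ℝ}

theorem mono (hφ : IsSubharmonicOn φ T) (hST : S ⊆ T) : IsSubharmonicOn φ S where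
  lt_top t ht := hφ.lt_top t (hST ht)
  usc := hφ.usc.mono hST
  le_of_le_harmonic _ _ _ hr hS := hφ.le_of_le_harmonic hr (hS.trans hST)

theorem le_of_le_harmonic_sub_norm_sq (hφ : IsSubharmonicOn φ (closedBall c r)) (hr : 0 ≤ r)
    (hh : HarmonicOnNhd h (closedBall c r))
    (hle : ∀ t ∈ sphere c r, φ t ≤ ↑(h t - ε * ‖t‖ ^ 2)) :
    φ c ≤ ↑(h c - ε * (‖c‖ ^ 2 + r ^ 2)) := by
  -- On the circle, `‖t‖ ^ 2` agrees with a harmonic function.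
  let k : ℂ → ℝ := (h - ε • fun t => (2 * conj c * t).re) + fun _ => ε * (‖c‖ ^ 2 - r ^ 2)
  have hk : HarmonicOnNhd k (closedBall c r) := fun t ht =>
    ((hh t ht).sub (HarmonicAt.const_smul
      (AnalyticAt.harmonicAt_re (f := fun t : ℂ => 2 * conj c * t) (by fun_prop)))).add
      (harmonicAt_const _)
  have hkc : k c = h c - ε * (‖c‖ ^ 2 + r ^ 2) := by
    have : (2 * conj c * c).re = 2 * ‖c‖ ^ 2 := by
      rw [mul_assoc, Complex.conj_mul']
      norm_cast
    simp only [k, Pi.add_apply, Pi.sub_apply, Pi.smul_apply, smul_eq_mul, this]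
    ring
  rw [← hkc]
  refine hφ.le_of_le_harmonic hr subset_rfl hk fun t ht => (hle t ht).trans_eq ?_
  rw [norm_sq_eq_re_of_mem_sphere ht]
  simp only [k, Pi.add_apply, Pi.sub_apply, Pi.smul_apply, smul_eq_mul]
  congr 1
  ring

theorem le_add_of_le_frontier (hφ : IsSubharmonicOn φ K) (hK : IsCompact K)
    (hh : HarmonicOnNhd h K) (hle : ∀ t ∈ frontier K, φ t ≤ h t) {R : ℝ}
    (hR : ∀ t ∈ K, ‖t‖ ≤ R) (hε : 0 < ε) {t : ℂ} (ht : t ∈ K) : φ t ≤ ↑(h t + ε * R ^ 2) := by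
  have hg : ContinuousOn (fun t => h t - ε * ‖t‖ ^ 2) K :=
    hh.continuousOn.sub (by fun_prop)
  obtain hbot | ⟨a, c, hcK, hc, hmax⟩ := exists_add_const_touching hK hφ.usc hφ.lt_top hg
  · simp [hbot t ht]
  have hfr : c ∈ frontier K := by
    refine ⟨subset_closure hcK, fun hint => ?_⟩
    obtain ⟨r, hr, hrK⟩ := nhds_basis_closedBall.mem_iff.1 (mem_interior_iff_mem_nhds.1 hint)
    have hlt := (hφ.mono hrK).le_of_le_harmonic_sub_norm_sq (h := h + fun _ => a) (ε := ε) hr.le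
      (fun s hs => (hh s (hrK hs)).add (harmonicAt_const _)) fun s hs => by
        convert hmax s (hrK (sphere_subset_closedBall hs)) using 2
        simp only [Pi.add_apply]
        ring
    rw [hc, EReal.coe_le_coe_iff, Pi.add_apply] at hlt
    nlinarith [mul_pos hε (pow_pos hr 2)]
  have ha : a ≤ ε * ‖c‖ ^ 2 := by
    have := hle c hfr
    rw [hc, EReal.coe_le_coe_iff] at this
    linarith
  have hcR : ε * ‖c‖ ^ 2 ≤ ε * R ^ 2 := by gcongr; exact hR c hcK
  refine (hmax t ht).trans (EReal.coe_le_coe_iff.2 ?_)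
  nlinarith [mul_nonneg hε.le (sq_nonneg ‖t‖)]

theorem le_of_le_frontier (hφ : IsSubharmonicOn φ K) (hK : IsCompact K) (hh : HarmonicOnNhd h K)
    (hle : ∀ t ∈ frontier K, φ t ≤ h t) {t : ℂ} (ht : t ∈ K) : φ t ≤ h t := by
  obtain ⟨R, hR⟩ := hK.isBounded.exists_norm_le
  have hlim : Tendsto (fun ε : ℝ => ((h t + ε * R ^ 2 : ℝ) : EReal)) (𝓝[>] 0) (𝓝 (h t)) := by
    refine (continuous_coe_real_ereal.tendsto _).comp ?_
    refine (Continuous.tendsto' ?_ 0 _ ?_).mono_left nhdsWithin_le_nhds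
    · fun_prop
    · ring
  refine ge_of_tendsto hlim ?_
  filter_upwards [self_mem_nhdsWithin] with ε hε
  exact hφ.le_add_of_le_frontier hK hh hle hR hε ht

end IsSubharmonicOn

/-! ### Logarithmic poles in the disc -/

theorem elog_of_pos {t : ℝ} (ht : 0 < t) : elog t = Real.log t :=
  ENNReal.log_ofReal_of_pos ht

theorem elog_mono : Monotone elog := fun _ _ hst =>
  ENNReal.log_monotone (ENNReal.ofReal_le_ofReal hst)

theorem elog_rpow_of_pos {t : ℝ} (ht : 0 < t) (m : ℝ) : elog (t ^ m) = ↑(m * Real.log t) := by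
  rw [elog_of_pos (Real.rpow_pos_of_pos ht m), Real.log_rpow ht]

theorem eventually_mul_norm_rpow_le {r k m C : ℝ} (hr : 0 < r) (hkm : k < m) :
    ∀ᶠ t : ℂ in 𝓝[≠] 0, C * ‖t‖ ^ m ≤ (‖t‖ / r) ^ k := by
  have hlim : Tendsto (fun t : ℂ => C * ‖t‖ ^ (m - k)) (𝓝[≠] 0) (𝓝 0) := by
    refine ((Continuous.tendsto' ?_ 0 _ ?_).mono_left nhdsWithin_le_nhds)
    · exact continuous_const.mul (continuous_norm.rpow_const fun _ => .inr (by linarith))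
    · simp [Real.zero_rpow (sub_pos.2 hkm).ne']
  filter_upwards [hlim.eventually_le_const (Real.rpow_pos_of_pos hr (-k)),
    self_mem_nhdsWithin] with t hle ht
  have ht0 : 0 < ‖t‖ := norm_pos_iff.2 ht
  calc C * ‖t‖ ^ m = C * ‖t‖ ^ (m - k) * ‖t‖ ^ k := by
        rw [mul_assoc, ← Real.rpow_add ht0, sub_add_cancel]
    _ ≤ r ^ (-k) * ‖t‖ ^ k := by gcongr
    _ = (‖t‖ / r) ^ k := by
        rw [Real.div_rpow ht0.le hr.le, Real.rpow_neg hr.le, mul_comm, div_eq_mul_inv]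

namespace IsSubharmonicOn

variable {φ : ℂ → EReal} {η r R k m C : ℝ} {t : ℂ}

theorem le_mul_log_of_annulus (hη : 0 < η)
    (hφ : IsSubharmonicOn φ (closedBall 0 r \ ball 0 η))
    (hinner : ∀ t ∈ sphere (0 : ℂ) η, φ t ≤ ↑(k * Real.log (‖t‖ / r)))
    (houter : ∀ t ∈ sphere (0 : ℂ) r, φ t ≤ 0) (hηt : η ≤ ‖t‖) (htr : ‖t‖ ≤ r) :
    φ t ≤ ↑(k * Real.log (‖t‖ / r)) := by
  have hr : 0 < r := hη.trans_le (hηt.trans htr)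
  have hharm : HarmonicOnNhd (k • fun t : ℂ => Real.log ‖t / r‖) (closedBall 0 r \ ball 0 η) := by
    intro s hs
    have hs0 : s ≠ 0 := norm_pos_iff.1 (hη.trans_le (by simpa using hs.2))
    exact (AnalyticAt.harmonicAt_log_norm (f := fun s : ℂ => s / r) (by fun_prop)
      (div_ne_zero hs0 (by exact_mod_cast hr.ne'))).const_smul
  have hfr : frontier (closedBall (0 : ℂ) r \ ball 0 η) ⊆ sphere 0 r ∪ sphere 0 η := by
    rw [Set.sdiff_eq]
    refine (frontier_inter_subset _ _).trans (Set.union_subset_union ?_ ?_)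
    · exact Set.inter_subset_left.trans frontier_closedBall_subset_sphere
    · rw [frontier_compl]
      exact Set.inter_subset_right.trans frontier_ball_subset_sphere
  have hnorm : ∀ s : ℂ, ‖s / (r : ℂ)‖ = ‖s‖ / r := fun s => by
    rw [norm_div, Complex.norm_real, Real.norm_of_nonneg hr.le]
  simpa only [Pi.smul_apply, smul_eq_mul, hnorm] using
    hφ.le_of_le_frontier ((isCompact_closedBall 0 r).diff isOpen_ball) hharm
      (fun s hs => by
        simp only [Pi.smul_apply, smul_eq_mul, hnorm]
        rcases hfr hs with hs | hs
        · simpa [mem_sphere_zero_iff_norm.1 hs, hr.ne'] using houter s hs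
        · exact hinner s hs)
      (t := t) (by simp [hηt, htr])

theorem le_mul_log_of_eventually_le (hφ : IsSubharmonicOn φ (closedBall 0 r))
    (hneg : ∀ t ∈ closedBall 0 r, φ t ≤ 0) (hpole : ∀ᶠ t in 𝓝 0, φ t ≤ elog (C * ‖t‖ ^ m))
    (hkm : k < m) (ht0 : t ≠ 0) (htr : ‖t‖ ≤ r) : φ t ≤ ↑(k * Real.log (‖t‖ / r)) := by
  have htpos : 0 < ‖t‖ := norm_pos_iff.2 ht0
  have hr : 0 < r := htpos.trans_le htr
  -- Since `k < m`, the constant `C` is absorbed on a small circle around the pole.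
  obtain ⟨ρ, hρ, hρle⟩ := nhdsWithin_basis_ball.eventually_iff.1
    ((hpole.filter_mono nhdsWithin_le_nhds).and (eventually_mul_norm_rpow_le hr hkm (C := C)))
  obtain ⟨η, hη, hηlt⟩ := exists_between (lt_min hρ htpos)
  rw [lt_min_iff] at hηlt
  refine (hφ.mono Set.sdiff_subset).le_mul_log_of_annulus hη (fun s hs => ?_)
    (fun s hs => hneg s (sphere_subset_closedBall hs)) hηlt.2.le htr
  have hsη : ‖s‖ = η := mem_sphere_zero_iff_norm.1 hs
  have hspos : 0 < ‖s‖ := hsη ▸ hη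
  obtain ⟨hle, hle'⟩ := hρle (x := s) ⟨by simpa [hsη] using hηlt.1, norm_pos_iff.1 hspos⟩
  exact (hle.trans (elog_mono hle')).trans_eq (elog_rpow_of_pos (div_pos hspos hr) k)

theorem le_elog_div_rpow_of_eventually_le (hφ : IsSubharmonicOn φ (ball 0 R))
    (hneg : ∀ t ∈ ball 0 R, φ t ≤ 0) (hpole : ∀ᶠ t in 𝓝 0, φ t ≤ elog (C * ‖t‖ ^ m))
    (ht : t ∈ ball 0 R) :
    φ t ≤ elog ((‖t‖ / R) ^ m) := by
  rcases eq_or_ne t 0 with rfl | ht0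
  · rcases eq_or_ne m 0 with rfl | hm
    · simpa [elog_of_pos] using hneg 0 ht
    · simpa [Real.zero_rpow hm] using hpole.self_of_nhds
  rw [mem_ball_zero_iff] at ht
  have htpos : 0 < ‖t‖ := norm_pos_iff.2 ht0
  have hR : 0 < R := htpos.trans ht
  rw [elog_rpow_of_pos (div_pos htpos hR)]
  have hlim : Tendsto (fun r => (((m - (R - r)) * Real.log (‖t‖ / r) : ℝ) : EReal)) (𝓝[<] R)
      (𝓝 ↑(m * Real.log (‖t‖ / R))) := by
    refine (continuous_coe_real_ereal.tendsto _).comp ?_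
    have hdiv : ContinuousAt (fun r => ‖t‖ / r) R := continuousAt_const.div₀ continuousAt_id hR.ne'
    have hcont : ContinuousAt (fun r => (m - (R - r)) * Real.log (‖t‖ / r)) R :=
      (continuousAt_const.sub (continuousAt_const.sub continuousAt_id)).mul
        (hdiv.log (div_pos htpos hR).ne')
    simpa using hcont.tendsto.mono_left nhdsWithin_le_nhds
  refine ge_of_tendsto hlim ?_
  filter_upwards [Ioo_mem_nhdsLT ht] with r hr
  have hsub : closedBall (0 : ℂ) r ⊆ ball 0 R := closedBall_subset_ball hr.2
  exact (hφ.mono hsub).le_mul_log_of_eventually_le (fun s hs => hneg s (hsub hs)) hpole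
    (by linarith [hr.2]) ht0 hr.1.le

end IsSubharmonicOn

/-! ### Plurisubharmonic functions on complex lines -/

theorem coe_integral_eq_lintegral_sub_lintegral {α : Type*} [MeasurableSpace α] {μ : Measure α}
    {f : α → ℝ} (hf : Integrable f μ) :
    ((∫ x, f x ∂μ : ℝ) : EReal) =
      ((∫⁻ x, ENNReal.ofReal (f x) ∂μ : ℝ≥0∞) : EReal)
        - ((∫⁻ x, ENNReal.ofReal (-f x) ∂μ : ℝ≥0∞) : EReal) := by
  rw [integral_eq_lintegral_pos_part_sub_lintegral_neg_part hf, EReal.coe_sub,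
    EReal.coe_ennreal_toReal hf.lintegral_lt_top.ne,
    EReal.coe_ennreal_toReal (by simpa using hf.neg.lintegral_lt_top.ne)]

theorem circleMean_le_circleAverage {n : ℕ} {u : Cn n → EReal} {a b : Cn n} {h : ℂ → ℝ}
    (hh : CircleIntegrable h 0 1) (hle : ∀ t ∈ sphere (0 : ℂ) 1, u (a + t • b) ≤ h t) :
    circleMean u a b ≤ Real.circleAverage h 0 1 := by
  set μ : Measure ℝ := volume.restrict (Set.Ioc 0 (2 * Real.pi))
  set f : ℝ → ℝ := fun θ => h (Complex.exp (θ * Complex.I))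
  have hmap : ∀ θ : ℝ, circleMap 0 1 θ = Complex.exp (θ * Complex.I) := by simp [circleMap]
  have hf : IntegrableOn f (Set.Ioc 0 (2 * Real.pi)) := by
    simpa only [CircleIntegrable, hmap,
      intervalIntegrable_iff_integrableOn_Ioc_of_le Real.two_pi_pos.le] using hh
  have hint : Integrable f ((μ Set.univ)⁻¹ • μ) :=
    Integrable.smul_measure hf (by simp [μ, Real.pi_pos])
  have havg : Real.circleAverage h 0 1 = ∫ θ, f θ ∂((μ Set.univ)⁻¹ • μ) := by
    simp only [Real.circleAverage_eq_intervalAverage, Set.uIoc_of_le Real.two_pi_pos.le, hmap]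
    rfl
  have hle' : ∀ θ : ℝ, u (a + Complex.exp (θ * Complex.I) • b) ≤ f θ := fun θ =>
    hle _ (by simp [Complex.norm_exp_ofReal_mul_I])
  rw [havg, coe_integral_eq_lintegral_sub_lintegral hint]
  refine EReal.sub_le_sub (EReal.coe_ennreal_le_coe_ennreal_iff.2 ?_)
    (EReal.coe_ennreal_le_coe_ennreal_iff.2 ?_) <;> refine lintegral_mono fun θ => ?_
  · simpa using EReal.toENNReal_le_toENNReal (hle' θ)
  · simpa [← EReal.coe_neg] using
      EReal.toENNReal_le_toENNReal (EReal.neg_le_neg_iff.2 (hle' θ))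

theorem IsPSH.isSubharmonicOn_line {n : ℕ} {D : Set (Cn n)} {u : Cn n → EReal} (hu : IsPSH D u)
    (a b : Cn n) : IsSubharmonicOn (fun t => u (a + t • b)) {t | a + t • b ∈ D} where
  lt_top t ht := hu.lt_top _ ht
  usc := hu.usc.comp (by fun_prop) fun _ ht => ht
  le_of_le_harmonic h c r hr hS hh hle := by
    have hline : ∀ t : ℂ, a + c • b + t • (r : ℂ) • b = a + (r * t + c) • b := fun t => by module
    have hmean := hu.le_circleMean (a + c • b) ((r : ℂ) • b) fun t ht => by
      rw [hline]
      exact hS (by simpa [abs_of_nonneg hr] using mul_le_of_le_one_right hr ht)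
    have hmaps : Set.MapsTo (fun t : ℂ => r * t + c) (sphere 0 1) (sphere c r) := fun t ht => by
      simp_all [abs_of_nonneg hr]
    calc u (a + c • b) ≤ circleMean u (a + c • b) ((r : ℂ) • b) := hmean
      _ ≤ Real.circleAverage (fun t => h (r * t + c)) 0 1 := by
        refine circleMean_le_circleAverage ?_ fun t ht => ?_
        · exact ((hh.continuousOn.mono sphere_subset_closedBall).comp (by fun_prop)
            hmaps).circleIntegrable zero_le_one
        · rw [hline]
          exact hle _ (hmaps ht)
      _ = Real.circleAverage h c r := by
        rw [← Real.circleAverage_eq_circleAverage_zero_one]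
      _ = h c := by
        rw [InnerProductSpace.HarmonicOnNhd.circleAverage_eq (by rwa [abs_of_nonneg hr])]

/-! ### Surrounding discs -/

theorem elog_one : elog 1 = 0 := by
  simp [elog]

theorem elog_mul_of_nonneg {s : ℝ} (hs : 0 ≤ s) (t : ℝ) : elog (s * t) = elog s + elog t := by
  rw [elog, ENNReal.ofReal_mul hs, ENNReal.log_mul_add, elog, elog]

theorem elog_le_elog_iff {s t : ℝ} (ht : 0 ≤ t) : elog s ≤ elog t ↔ s ≤ t := by
  rw [elog, elog, ENNReal.log_le_log_iff, ENNReal.ofReal_le_ofReal_iff ht]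

theorem exp_elog (t : ℝ) : EReal.exp (elog t) = ENNReal.ofReal t :=
  ENNReal.exp_log _

theorem IsSubharmonicOn.le_of_le_sphere {φ : ℂ → EReal} {c : ℂ} {r : ℝ} {t : ℂ} {M : EReal}
    (hφ : IsSubharmonicOn φ (closedBall c r)) (hle : ∀ t ∈ sphere c r, φ t ≤ M)
    (ht : t ∈ closedBall c r) : φ t ≤ M := by
  refine EReal.le_of_forall_lt_iff_le.1 fun a ha => ?_
  exact hφ.le_of_le_frontier (isCompact_closedBall c r) (fun _ _ => harmonicAt_const a)
    (fun s hs => (hle s (frontier_closedBall_subset_sphere hs)).trans ha.le) ht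

section Discs

variable {n : ℕ} {D : Set (Cn n)} {z X : Cn n} {R m : ℝ} {u : Cn n → EReal}

/-- The nonpositive plurisubharmonic functions on `D` having at `z` a logarithmic pole of order at
least `m`. The candidates for the Green function have order one, and the logarithms of the
candidates for the Sibony metric have order two. -/
def logPoleClass (D : Set (Cn n)) (z : Cn n) (m : ℝ) : Set (Cn n → EReal) :=
  {u | IsPSH D u ∧ (∀ w ∈ D, u w ≤ 0) ∧ ∃ C : ℝ, ∀ᶠ w in 𝓝 z, u w ≤ elog (C * ‖w - z‖ ^ m)}

/-- The discs of radius `R` centred at `z` in the directions `X + w • e`, `‖w‖ = 1`, lie in `D`.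
When `R` is small these surround the disc in the direction `X`, which itself may leave `D`. The
vector `e` may vanish, in which case all these discs coincide. -/
def HasSurroundingDiscs (D : Set (Cn n)) (z X : Cn n) (R : ℝ) : Prop :=
  ∃ e : Cn n, ∀ w : ℂ, ‖w‖ = 1 → ∀ s : ℂ, ‖s‖ < R → z + s • (X + w • e) ∈ D

theorem greenClass_subset_logPoleClass (hD : D ∈ 𝓝 z) : greenClass D z ⊆ logPoleClass D z 1 := by
  rintro u ⟨hpsh, hneg, C, hC⟩
  refine ⟨hpsh, fun w hw => (hneg w hw).le, Real.exp C, ?_⟩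
  filter_upwards [hD] with w hw
  rw [elog_mul_of_nonneg (Real.exp_pos C).le, elog_of_pos (Real.exp_pos C), Real.log_exp,
    Real.rpow_one, add_comm]
  exact hC w hw

theorem le_elog_of_disc_subset (hu : u ∈ logPoleClass D z m)
    (hX : ∀ t : ℂ, ‖t‖ < R → z + t • X ∈ D) {t : ℂ} (ht : ‖t‖ < R) :
    u (z + t • X) ≤ elog ((‖t‖ / R) ^ m) := by
  obtain ⟨hpsh, hneg, C, hC⟩ := hu
  have hsub : ball (0 : ℂ) R ⊆ {t | z + t • X ∈ D} := fun t ht => hX t (by simpa using ht)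
  refine ((hpsh.isSubharmonicOn_line z X).mono hsub).le_elog_div_rpow_of_eventually_le
    (C := C * ‖X‖ ^ m) (fun t ht => hneg _ (hsub ht)) ?_ (by simpa using ht)
  have hlim : Tendsto (fun t : ℂ => z + t • X) (𝓝 0) (𝓝 z) :=
    Continuous.tendsto' (by fun_prop) _ _ (by simp)
  filter_upwards [hlim.eventually hC] with t ht
  rwa [add_sub_cancel_left, norm_smul, Real.mul_rpow (norm_nonneg _) (norm_nonneg _),
    mul_left_comm, mul_comm] at ht

namespace HasSurroundingDiscs

theorem eventually_le_elog (h : HasSurroundingDiscs D z X R) (hD : D ∈ 𝓝 z) (hR : 0 < R) :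
    ∀ᶠ t : ℂ in 𝓝 0, ∀ m, ∀ u ∈ logPoleClass D z m, u (z + t • X) ≤ elog ((‖t‖ / R) ^ m) := by
  obtain ⟨e, he⟩ := h
  have hdisc : ∀ᶠ t : ℂ in 𝓝 0, ∀ w ∈ closedBall (0 : ℂ) 1, z + t • X + w • t • e ∈ D := by
    refine (isCompact_closedBall 0 1).eventually_forall_of_forall_eventually fun w _ => ?_
    have hlim : Tendsto (fun p : ℂ × ℂ => z + p.1 • X + p.2 • p.1 • e) (𝓝 (0, w)) (𝓝 z) :=
      Continuous.tendsto' (by fun_prop) _ _ (by simp)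
    exact hlim.eventually hD
  filter_upwards [hdisc, ball_mem_nhds 0 hR] with t hsub ht m u hu
  -- The maximum principle in `w` passes from the surrounding discs to the disc along `X`.
  have hline : ∀ w ∈ sphere (0 : ℂ) 1, u (z + t • X + w • t • e) ≤ elog ((‖t‖ / R) ^ m) := by
    intro w hw
    have : z + t • X + w • t • e = z + t • (X + w • e) := by module
    rw [this]
    exact le_elog_of_disc_subset hu (he w (by simpa using hw)) (by simpa using ht)
  simpa using ((hu.1.isSubharmonicOn_line (z + t • X) (t • e)).mono hsub).le_of_le_sphere hline
    (mem_closedBall_self zero_le_one)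

theorem azukawa_le (h : HasSurroundingDiscs D z X R) (hD : D ∈ 𝓝 z) (hR : 0 < R) :
    azukawa D z X ≤ ENNReal.ofReal R⁻¹ := by
  refine limsup_le_of_le (h := ?_)
  filter_upwards [nhdsWithin_le_nhds (h.eventually_le_elog hD hR), self_mem_nhdsWithin]
    with t ht ht0
  have htpos : 0 < ‖t‖ := norm_pos_iff.2 ht0
  have hgreen : pluricomplexGreen D z (z + t • X) ≤ elog (‖t‖ / R) := iSup₂_le fun u hu => by
    simpa using ht 1 u (greenClass_subset_logPoleClass hD hu)
  calc EReal.exp (pluricomplexGreen D z (z + t • X)) / ENNReal.ofReal ‖t‖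
      ≤ ENNReal.ofReal (‖t‖ / R) / ENNReal.ofReal ‖t‖ := by
        gcongr
        exact (EReal.exp_monotone hgreen).trans_eq (exp_elog _)
    _ = ENNReal.ofReal R⁻¹ := by
        rw [← ENNReal.ofReal_div_of_pos htpos, div_div_cancel_left' htpos.ne']

theorem azukawa_lt_one (h : HasSurroundingDiscs D z X R) (hD : D ∈ 𝓝 z) (hR : 1 < R) :
    azukawa D z X < 1 :=
  (h.azukawa_le hD (one_pos.trans hR)).trans_lt (ENNReal.ofReal_lt_one.2 (inv_lt_one_of_one_lt₀ hR))

end HasSurroundingDiscs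

end Discs

/-! ### The Levi form and the real Hessian -/

theorem exists_norm_sub_le_mul_norm_sq {E F : Type*} [NormedAddCommGroup E] [NormedSpace ℝ E]
    [NormedAddCommGroup F] [NormedSpace ℝ F] {f : E → F} {z : E} (hf : ContDiffAt ℝ 2 f z)
    (hz : fderiv ℝ f z = 0) : ∃ C : ℝ, ∀ᶠ w in 𝓝 z, ‖f w - f z‖ ≤ C * ‖w - z‖ ^ 2 := by
  obtain ⟨K, s, hs, hK⟩ := (hf.fderiv_right (m := 1) (by norm_num)).exists_lipschitzOnWith
  have hdiff : ∀ᶠ w in 𝓝 z, DifferentiableAt ℝ f w :=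
    (hf.eventually (by simp)).mono fun w hw => hw.differentiableAt (by norm_num)
  obtain ⟨r, hr, hball⟩ := eventually_nhds_iff_ball.1 (hdiff.and hs)
  refine ⟨K, ?_⟩
  filter_upwards [ball_mem_nhds z hr] with w hw
  have hseg : ∀ y ∈ closedBall z ‖w - z‖, y ∈ ball z r := fun y hy =>
    (mem_closedBall.1 hy).trans_lt (by rwa [← dist_eq_norm])
  have hderiv : ∀ y ∈ closedBall z ‖w - z‖, ‖fderiv ℝ f y‖ ≤ K * ‖w - z‖ := fun y hy => by
    have := hK.dist_le_mul y (hball y (hseg y hy)).2 z (mem_of_mem_nhds hs)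
    rw [hz, dist_zero_right] at this
    exact this.trans (mul_le_mul_of_nonneg_left hy K.2)
  refine ((convex_closedBall z ‖w - z‖).norm_image_sub_le_of_norm_fderiv_le
    (fun y hy => (hball y (hseg y hy)).1) hderiv (mem_closedBall_self (norm_nonneg _))
    (by simp [dist_eq_norm])).trans_eq ?_
  ring

theorem deriv_deriv_nonpos_of_isLocalMax {f : ℝ → ℝ} {x : ℝ} (hmax : IsLocalMax f x)
    (hf : ContinuousAt f x) : deriv (deriv f) x ≤ 0 := by
  by_contra! hpos
  have hmin : IsLocalMin f x := isLocalMin_of_deriv_deriv_pos hpos hmax.deriv_eq_zero hf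
  have hconst : f =ᶠ[𝓝 x] fun _ => f x := (hmax.and hmin).mono fun _ hs => le_antisymm hs.1 hs.2
  simp [hconst.deriv.deriv_eq] at hpos

theorem deriv_deriv_le_of_eventually_le {f : ℝ → ℝ} {x M : ℝ} (hf : ContDiffAt ℝ 2 f x)
    (hle : ∀ᶠ s in 𝓝 x, f s ≤ f x + M * (s - x) ^ 2) : deriv (deriv f) x ≤ 2 * M := by
  set g : ℝ → ℝ := fun s => f s - M * (s - x) ^ 2 with hg
  have hdiff : ∀ᶠ s in 𝓝 x, DifferentiableAt ℝ f s :=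
    (hf.eventually (by simp)).mono fun s hs => hs.differentiableAt (by norm_num)
  have hsq : ∀ s, HasDerivAt (fun s => M * (s - x) ^ 2) (2 * M * (s - x)) s := fun s =>
    ((((hasDerivAt_id s).sub_const x).pow 2).const_mul M).congr_deriv (by simp; ring)
  have hderiv : deriv g =ᶠ[𝓝 x] fun s => deriv f s - 2 * M * (s - x) :=
    hdiff.mono fun s hs => (hs.hasDerivAt.sub (hsq s)).deriv
  have hderiv2 : deriv (deriv g) x = deriv (deriv f) x - 2 * M := by
    have hf' : DifferentiableAt ℝ (deriv f) x :=
      (hf.derivWithin (m := 1) (by norm_num)).differentiableAt (by norm_num)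
    rw [hderiv.deriv_eq]
    exact (hf'.hasDerivAt.sub
      ((((hasDerivAt_id x).sub_const x).const_mul (2 * M)).congr_deriv (by simp))).deriv
  have hmax : IsLocalMax g x := hle.mono fun s hs => by
    simp only [hg, sub_self]
    linarith
  have := deriv_deriv_nonpos_of_isLocalMax hmax
    (hdiff.self_of_nhds.continuousAt.sub (hsq x).continuousAt)
  linarith

theorem deriv_deriv_comp_add_smul {E : Type*} [NormedAddCommGroup E] [NormedSpace ℝ E] {f : E → ℝ}
    {z : E} (hf : ContDiffAt ℝ 2 f z) (Y : E) :
    deriv (deriv fun s : ℝ => f (z + s • Y)) 0 = fderiv ℝ (fderiv ℝ f) z Y Y := by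
  have hline : ∀ s : ℝ, HasDerivAt (fun s : ℝ => z + s • Y) Y s := fun s => by
    simpa using ((hasDerivAt_id s).smul_const Y).const_add z
  have hlim : Tendsto (fun s : ℝ => z + s • Y) (𝓝 0) (𝓝 z) := by
    simpa using (hline 0).continuousAt.tendsto
  have hfirst : deriv (fun s : ℝ => f (z + s • Y)) =ᶠ[𝓝 0] fun s => fderiv ℝ f (z + s • Y) Y := by
    filter_upwards [hlim.eventually (hf.eventually (by simp))] with s hs
    exact ((hs.differentiableAt (by norm_num)).hasFDerivAt.comp_hasDerivAt s (hline s)).deriv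
  have hsecond : HasFDerivAt (fderiv ℝ f) (fderiv ℝ (fderiv ℝ f) z) z :=
    ((hf.fderiv_right (m := 1) (by norm_num)).differentiableAt (by norm_num)).hasFDerivAt
  have hsecondY : HasFDerivAt (fun w => fderiv ℝ f w Y) ((fderiv ℝ (fderiv ℝ f) z).flip Y)
      (z + (0 : ℝ) • Y) := by
    simpa using hsecond.clm_apply (hasFDerivAt_const Y z)
  rw [hfirst.deriv_eq]
  exact (hsecondY.comp_hasDerivAt (0 : ℝ) (hline 0)).deriv

section LeviForm

variable {n : ℕ} {D : Set (Cn n)} {v : Cn n → ℝ} {z X : Cn n} {R : ℝ}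

theorem wirtinger_wirtingerBar (hv : ContDiffAt ℝ 2 v z) (j k : Fin n) :
    wirtinger j (wirtingerBar k (fun w => (v w : ℂ))) z = (1 / 4) *
      ((fderiv ℝ (fderiv ℝ v) z (EuclideanSpace.single j 1) (EuclideanSpace.single k 1) : ℂ)
      + fderiv ℝ (fderiv ℝ v) z (EuclideanSpace.single j Complex.I)
          (EuclideanSpace.single k Complex.I)
      + Complex.I * (fderiv ℝ (fderiv ℝ v) z (EuclideanSpace.single j 1)
          (EuclideanSpace.single k Complex.I)
        - fderiv ℝ (fderiv ℝ v) z (EuclideanSpace.single j Complex.I)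
          (EuclideanSpace.single k 1))) := by
  set B := fderiv ℝ (fderiv ℝ v) z
  have hB : HasFDerivAt (fderiv ℝ v) B z :=
    ((hv.fderiv_right (m := 1) (by norm_num)).differentiableAt (by norm_num)).hasFDerivAt
  have hfirst : wirtingerBar k (fun w => (v w : ℂ)) =ᶠ[𝓝 z] fun w =>
      (1 / 2 : ℂ) * ((fderiv ℝ v w (EuclideanSpace.single k 1) : ℂ)
        + Complex.I * (fderiv ℝ v w (EuclideanSpace.single k Complex.I) : ℂ)) := by
    filter_upwards [hv.eventually (by simp)] with w hw
    have hv' := Complex.ofRealCLM.hasFDerivAt.comp w (hw.differentiableAt (by norm_num)).hasFDerivAt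
    have : fderiv ℝ (fun w => (v w : ℂ)) w = Complex.ofRealCLM.comp (fderiv ℝ v w) := hv'.fderiv
    simp [wirtingerBar, this]
  have happly : ∀ a : Cn n, HasFDerivAt (fun w => (fderiv ℝ v w a : ℂ))
      (Complex.ofRealCLM.comp (B.flip a)) z := fun a => by
    have : HasFDerivAt (fun w => fderiv ℝ v w a) (B.flip a) z := by
      simpa using hB.clm_apply (hasFDerivAt_const a z)
    exact Complex.ofRealCLM.hasFDerivAt.comp z this
  have hsecond := ((happly (EuclideanSpace.single k 1)).add
    ((happly (EuclideanSpace.single k Complex.I)).const_mul Complex.I)).const_mul (1 / 2 : ℂ)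
  simp only [wirtinger, hfirst.fderiv_eq.trans hsecond.fderiv]
  simp only [one_div, smul_add, add_apply, smul_apply, ContinuousLinearMap.comp_apply,
    ContinuousLinearMap.flip_apply, Complex.ofRealCLM_apply, smul_eq_mul]
  linear_combination (-(1 / 4 : ℂ) * B (EuclideanSpace.single j Complex.I)
    (EuclideanSpace.single k Complex.I)) * Complex.I_sq

theorem eq_sum_re_smul_single_add_im_smul_single (X : Cn n) :
    X = ∑ j, ((X j).re • EuclideanSpace.single j (1 : ℂ)
      + (X j).im • EuclideanSpace.single j Complex.I) := by
  ext i
  simp [Pi.single_apply, Finset.sum_add_distrib]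

theorem bilin_apply_self_eq_sum_single (B : Cn n →L[ℝ] Cn n →L[ℝ] ℝ) (X : Cn n) :
    B X X = ∑ j, ∑ k,
      ((X j).re * (X k).re * B (EuclideanSpace.single j 1) (EuclideanSpace.single k 1)
      + (X j).re * (X k).im * B (EuclideanSpace.single j 1) (EuclideanSpace.single k Complex.I)
      + (X j).im * (X k).re * B (EuclideanSpace.single j Complex.I) (EuclideanSpace.single k 1)
      + (X j).im * (X k).im * B (EuclideanSpace.single j Complex.I)
          (EuclideanSpace.single k Complex.I)) := by
  conv_lhs => rw [eq_sum_re_smul_single_add_im_smul_single X]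
  rw [map_sum B, sum_apply]
  refine Finset.sum_congr rfl fun j _ => ?_
  rw [map_sum]
  refine Finset.sum_congr rfl fun k _ => ?_
  simp only [map_add, map_smul, add_apply, smul_apply, smul_eq_mul]
  ring

theorem leviForm_eq_hessian (hv : ContDiffAt ℝ 2 v z) (X : Cn n) :
    leviForm v z X = (fderiv ℝ (fderiv ℝ v) z X X
      + fderiv ℝ (fderiv ℝ v) z (Complex.I • X) (Complex.I • X)) / 4 := by
  simp only [leviForm, wirtinger_wirtingerBar hv, bilin_apply_self_eq_sum_single _ X,
    bilin_apply_self_eq_sum_single _ (Complex.I • X), Complex.re_sum, ← Finset.sum_add_distrib,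
    Finset.sum_div]
  refine Finset.sum_congr rfl fun j _ => Finset.sum_congr rfl fun k _ => ?_
  simp only [one_div, Complex.mul_re, Complex.inv_re, Complex.re_ofNat, Complex.normSq_ofNat,
    div_self_mul_self', Complex.add_re, Complex.ofReal_re, Complex.I_re, Complex.sub_re, zero_mul,
    Complex.I_im, Complex.sub_im, Complex.ofReal_im, sub_self, mul_zero, add_zero, Complex.inv_im,
    Complex.im_ofNat, neg_zero, zero_div, Complex.add_im, Complex.mul_im, one_mul, zero_add,
    sub_zero, Complex.conj_re, Complex.conj_im, mul_neg, sub_neg_eq_add, PiLp.smul_apply,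
    smul_eq_mul, zero_sub, neg_mul, neg_neg]
  ring

theorem leviForm_le_of_eventually_le {M : ℝ} (hv : ContDiffAt ℝ 2 v z)
    (hle : ∀ᶠ t : ℂ in 𝓝 0, v (z + t • X) ≤ v z + M * ‖t‖ ^ 2) : leviForm v z X ≤ M := by
  have hline : ∀ c : ℂ, ‖c‖ = 1 → fderiv ℝ (fderiv ℝ v) z (c • X) (c • X) ≤ 2 * M := fun c hc => by
    have hcont : ContDiffAt ℝ 2 (fun s : ℝ => v (z + s • c • X)) 0 :=
      ContDiffAt.comp 0 (by simpa using hv) (by fun_prop)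
    have hlim : Tendsto (fun s : ℝ => (s : ℂ) * c) (𝓝 0) (𝓝 0) :=
      Continuous.tendsto' (by fun_prop) _ _ (by simp)
    rw [← deriv_deriv_comp_add_smul hv]
    refine deriv_deriv_le_of_eventually_le hcont ?_
    filter_upwards [hlim.eventually hle] with s hs
    simpa [mul_smul, hc] using hs
  have hre := hline 1 norm_one
  have him := hline Complex.I Complex.norm_I
  rw [one_smul] at hre
  rw [leviForm_eq_hessian hv]
  linarith

theorem elog_comp_mem_logPoleClass (hv : v ∈ sibonyClass D z) (hD : D ∈ 𝓝 z) :
    (fun w => elog (v w)) ∈ logPoleClass D z 2 := by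
  obtain ⟨hv01, hvz, hpsh, hC2⟩ := hv
  have hmin : IsLocalMin v z := by
    filter_upwards [hD] with w hw
    rw [hvz]
    exact (hv01 w hw).1
  refine ⟨hpsh, fun w hw => (elog_mono (hv01 w hw).2.le).trans_eq elog_one, ?_⟩
  obtain ⟨C, hC⟩ := exists_norm_sub_le_mul_norm_sq hC2 hmin.fderiv_eq_zero
  refine ⟨C, hC.mono fun w hw => elog_mono ?_⟩
  rw [hvz, sub_zero] at hw
  exact_mod_cast (Real.le_norm_self _).trans hw

theorem HasSurroundingDiscs.leviForm_le (h : HasSurroundingDiscs D z X R) (hD : D ∈ 𝓝 z)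
    (hR : 0 < R) (hv : v ∈ sibonyClass D z) : leviForm v z X ≤ R⁻¹ ^ 2 := by
  refine leviForm_le_of_eventually_le hv.2.2.2 ?_
  filter_upwards [h.eventually_le_elog hD hR] with t ht
  have := ht 2 _ (elog_comp_mem_logPoleClass hv hD)
  rw [elog_le_elog_iff (by positivity), Real.rpow_two, div_pow] at this
  rw [hv.2.1, zero_add, inv_pow, inv_mul_eq_div]
  exact this

theorem HasSurroundingDiscs.sibony_le (h : HasSurroundingDiscs D z X R) (hD : D ∈ 𝓝 z)
    (hR : 0 < R) : sibony D z X ≤ ENNReal.ofReal R⁻¹ :=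
  iSup₂_le fun _ hv => ENNReal.ofReal_le_ofReal <|
    Real.sqrt_le_iff.2 ⟨(inv_pos.2 hR).le, h.leviForm_le hD hR hv⟩

theorem HasSurroundingDiscs.sibony_lt_one (h : HasSurroundingDiscs D z X R) (hD : D ∈ 𝓝 z)
    (hR : 1 < R) : sibony D z X < 1 :=
  (h.sibony_le hD (one_pos.trans hR)).trans_lt (ENNReal.ofReal_lt_one.2 (inv_lt_one_of_one_lt₀ hR))

end LeviForm

/-! ### Lipschitz boundaries -/

/-- `F` grows at rate at least `κ` in the direction `e`. For `κ > 0` and `F` Lipschitz, the sublevel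
sets of `F` are then the regions below Lipschitz graphs in the direction `e`. -/
def IsIncreasingAlong {E : Type*} [AddCommGroup E] [Module ℝ E] (F : E → ℝ) (e : E) (κ : ℝ) :
    Prop :=
  ∀ (w : E) ⦃h : ℝ⦄, 0 ≤ h → F w + κ * h ≤ F (w + h • e)

namespace IsIncreasingAlong

section Module

variable {E : Type*} [AddCommGroup E] [Module ℝ E] {F : E → ℝ} {e : E} {κ : ℝ}

theorem smul_right (hF : IsIncreasingAlong F e κ) {c : ℝ} (hc : 0 ≤ c) :
    IsIncreasingAlong F (c • e) (κ * c) := fun w h hh => by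
  simpa only [smul_smul, mul_comm, mul_left_comm] using hF w (mul_nonneg hh hc)

theorem neg_neg (hF : IsIncreasingAlong F e κ) : IsIncreasingAlong (-F) (-e) κ := fun w h hh => by
  have := hF (w - h • e) hh
  rw [sub_add_cancel] at this
  simp only [Pi.neg_apply, smul_neg, ← sub_eq_add_neg]
  linarith

theorem mul_sub_le (hF : IsIncreasingAlong F e κ) (w : E) {s t : ℝ} (hst : s ≤ t) :
    κ * (t - s) ≤ F (w + t • e) - F (w + s • e) := by
  have := hF (w + s • e) (sub_nonneg.2 hst)
  rw [add_assoc, ← add_smul, add_sub_cancel] at this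
  linarith

theorem strictMono_line (hF : IsIncreasingAlong F e κ) (hκ : 0 < κ) (w : E) :
    StrictMono fun s : ℝ => F (w + s • e) := fun s t hst => by
  have := hF.mul_sub_le w hst.le
  nlinarith [mul_pos hκ (sub_pos.2 hst)]

theorem mul_abs_sub_le (hF : IsIncreasingAlong F e κ) (w : E) (s t : ℝ) :
    κ * |s - t| ≤ |F (w + s • e) - F (w + t • e)| := by
  wlog hst : t ≤ s generalizing s t
  · rw [abs_sub_comm s, abs_sub_comm (F _)]
    exact this t s (le_of_not_ge hst)
  rw [abs_of_nonneg (sub_nonneg.2 hst)]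
  exact (hF.mul_sub_le w hst).trans (le_abs_self _)

end Module

section Normed

variable {E : Type*} [NormedAddCommGroup E] [NormedSpace ℝ E] {F : E → ℝ} {e : E} {κ : ℝ}

theorem surjective_line (hF : IsIncreasingAlong F e κ) (hκ : 0 < κ) (hcont : Continuous F) (w : E) :
    Function.Surjective fun s : ℝ => F (w + s • e) := by
  have hzero := fun s t hst => hF.mul_sub_le w (s := s) (t := t) hst
  refine Continuous.surjective (by fun_prop) ?_ ?_
  · refine tendsto_atTop_mono' _ ?_ (tendsto_atTop_add_const_left _ (F (w + (0 : ℝ) • e))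
      (tendsto_id.const_mul_atTop hκ))
    filter_upwards [eventually_ge_atTop 0] with s hs
    have := hzero 0 s hs
    simp only [id]
    linarith
  · refine tendsto_atBot_mono' _ ?_ (tendsto_atBot_add_const_left _ (F (w + (0 : ℝ) • e))
      (tendsto_id.const_mul_atBot hκ))
    filter_upwards [eventually_le_atBot 0] with s hs
    have := hzero s 0 hs
    simp only [id]
    linarith

theorem exists_lipschitz_graph (hF : IsIncreasingAlong F e κ) (hκ : 0 < κ) {L : ℝ≥0}
    (hL : LipschitzWith L F) (r : ℝ) :
    ∃ (K : ℝ≥0) (f : E → ℝ), LipschitzWith K f ∧ ∀ w s, F (w + s • e) < r ↔ s < f w := by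
  have hroot : ∀ w, ∃ s : ℝ, F (w + s • e) = r := fun w => hF.surjective_line hκ hL.continuous w r
  choose f hf using hroot
  refine ⟨(L / κ).toNNReal, f, LipschitzWith.of_dist_le' fun w w' => ?_, fun w s => ?_⟩
  · rw [Real.dist_eq, div_mul_eq_mul_div, le_div_iff₀' hκ]
    calc κ * |f w - f w'| ≤ |F (w + f w • e) - F (w + f w' • e)| := hF.mul_abs_sub_le w _ _
      _ = dist (F (w' + f w' • e)) (F (w + f w' • e)) := by rw [hf w, hf w', Real.dist_eq]
      _ ≤ L * dist (w' + f w' • e) (w + f w' • e) := hL.dist_le_mul _ _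
      _ = L * dist w w' := by rw [dist_add_right, dist_comm]
  · conv_lhs => rw [← hf w]
    exact (hF.strictMono_line hκ w).lt_iff_lt

end Normed

theorem lipschitzBoundaryNear {n : ℕ} {D : Set (Cn n)} {p e : Cn n} {F : Cn n → ℝ} {κ r : ℝ}
    (hF : IsIncreasingAlong F e κ) (hκ : 0 < κ) (he : ‖e‖ = 1) {L : ℝ≥0} (hL : LipschitzWith L F)
    (hD : ∀ᶠ w in 𝓝 p, w ∈ D ↔ F w < r) : LipschitzBoundaryNear D p := by
  obtain ⟨K, f, hf, hlt⟩ := hF.exists_lipschitz_graph hκ hL r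
  refine ⟨e, he, K, f, hf, hD.mono fun w hw => ?_⟩
  rw [hw, ← hlt, sub_add_cancel]

end IsIncreasingAlong

section Shell

variable {E : Type*}

/-- The region between the spheres of radii `a` and `b` of the seminorm `N`, for which Lipschitz
boundaries are established. -/
def seminormShell [AddCommGroup E] [Module ℝ E] (N : Seminorm ℝ E) (a b : ℝ) : Set E :=
  {w | a < N w ∧ N w < b}

/-- The largest function below `N` that grows at rate at least `N p / 2` in the direction `p`. Near
`p` it agrees with `N`. -/
noncomputable def radialRegularization [AddCommGroup E] [Module ℝ E] (N : Seminorm ℝ E)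
    (p w : E) : ℝ :=
  ⨅ t : ℝ≥0, (N (w + (t : ℝ) • p) - t * (N p / 2))

section Module

variable [AddCommGroup E] [Module ℝ E] (N : Seminorm ℝ E) (p : E)

theorem radialRegularization_le (w : E) {t : ℝ} (ht : 0 ≤ t) :
    radialRegularization N p w ≤ N (w + t • p) - t * (N p / 2) := by
  refine ciInf_le (f := fun t : ℝ≥0 => N (w + (t : ℝ) • p) - t * (N p / 2)) ?_ ⟨t, ht⟩
  refine ⟨-N w, Set.forall_mem_range.2 fun s => ?_⟩
  have hs : (s : ℝ) * N p ≤ N (w + (s : ℝ) • p) + N w := by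
    simpa [map_smul_eq_mul, abs_of_nonneg s.2] using map_sub_le_add N (w + (s : ℝ) • p) w
  have hnonneg : 0 ≤ (s : ℝ) * N p := mul_nonneg s.2 (apply_nonneg N p)
  linarith

theorem le_radialRegularization {c : ℝ} {w : E}
    (h : ∀ t : ℝ, 0 ≤ t → c ≤ N (w + t • p) - t * (N p / 2)) : c ≤ radialRegularization N p w :=
  le_ciInf fun t => h t t.2

theorem isIncreasingAlong_radialRegularization :
    IsIncreasingAlong (radialRegularization N p) p (N p / 2) := fun w h hh => by
  refine le_radialRegularization N p fun t ht => ?_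
  have := radialRegularization_le N p w (add_nonneg hh ht)
  rw [add_smul, ← add_assoc] at this
  linarith

theorem radialRegularization_le_add (w w' : E) :
    radialRegularization N p w ≤ radialRegularization N p w' + N (w - w') := by
  rw [← sub_le_iff_le_add]
  refine le_radialRegularization N p fun t ht => ?_
  have htri : N (w + t • p) ≤ N (w' + t • p) + N (w - w') := by
    rw [show w + t • p = w' + t • p + (w - w') by abel]
    exact map_add_le_add N _ _
  linarith [radialRegularization_le N p w ht]

theorem radialRegularization_eq {w : E} (hw : 4 * N (w - p) ≤ N p) :
    radialRegularization N p w = N w := by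
  refine le_antisymm (by simpa using radialRegularization_le N p w le_rfl)
    (le_radialRegularization N p fun t ht => ?_)
  have hp : N p ≤ N w + N (w - p) := by
    simpa using map_sub_le_add N w (w - p)
  have hray : (1 + t) * N w ≤ N (w + t • p) + t * N (w - p) := by
    have : (1 + t) • w = (w + t • p) + t • (w - p) := by module
    simpa [map_smul_eq_mul, abs_of_nonneg, ht, add_nonneg, ← this] using
      map_add_le_add N (w + t • p) (t • (w - p))
  nlinarith

end Module

section Normed

variable [NormedAddCommGroup E] [NormedSpace ℝ E] {N : Seminorm ℝ E} {p : E} {a b : ℝ}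

theorem exists_lipschitzWith_radialRegularization (hN : Continuous N) (p : E) :
    ∃ L : ℝ≥0, LipschitzWith L (radialRegularization N p) := by
  obtain ⟨C, -, hC⟩ := N.bound_of_continuous_normedSpace hN
  refine ⟨_, LipschitzWith.of_le_add_mul' C fun w w' => ?_⟩
  rw [dist_eq_norm]
  exact (radialRegularization_le_add N p w w').trans (add_le_add_right (hC _) _)

theorem eventually_radialRegularization_eq (hN : Continuous N) (hp : 0 < N p) :
    ∀ᶠ w in 𝓝 p, radialRegularization N p w = N w := by
  have hlim : Tendsto (fun w => 4 * N (w - p)) (𝓝 p) (𝓝 0) :=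
    Continuous.tendsto' (by fun_prop) _ _ (by simp)
  exact (hlim.eventually_le_const hp).mono fun w hw => radialRegularization_eq N p hw

theorem exists_isIncreasingAlong_eventually_eq (hN : Continuous N) (hp : 0 < N p) :
    ∃ (F : E → ℝ) (e : E) (κ : ℝ) (L : ℝ≥0), IsIncreasingAlong F e κ ∧ 0 < κ ∧ ‖e‖ = 1 ∧
      LipschitzWith L F ∧ ∀ᶠ w in 𝓝 p, F w = N w := by
  have hp0 : p ≠ 0 := fun h => by simp [h] at hp
  obtain ⟨L, hL⟩ := exists_lipschitzWith_radialRegularization hN p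
  exact ⟨radialRegularization N p, ‖p‖⁻¹ • p, N p / 2 * ‖p‖⁻¹, L,
    (isIncreasingAlong_radialRegularization N p).smul_right (inv_nonneg.2 (norm_nonneg p)),
    mul_pos (half_pos hp) (inv_pos.2 (norm_pos_iff.2 hp0)), norm_smul_inv_norm (𝕜 := ℝ) hp0,
    hL, eventually_radialRegularization_eq hN hp⟩

theorem isOpen_seminormShell (hN : Continuous N) (a b : ℝ) : IsOpen (seminormShell N a b) :=
  (isOpen_lt continuous_const hN).inter (isOpen_lt hN continuous_const)

theorem isBounded_seminormShell (hN : ∀ w, ‖w‖ ≤ N w) (a b : ℝ) :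
    Bornology.IsBounded (seminormShell N a b) :=
  isBounded_iff_forall_norm_le.2 ⟨b, fun w hw => (hN w).trans hw.2.le⟩

theorem isConnected_seminormShell (hN : Continuous N) (hN0 : ∀ w, N w = 0 → w = 0)
    (hE : 1 < Module.rank ℝ E) (ha : 0 ≤ a) (hab : a < b) : IsConnected (seminormShell N a b) := by
  have hpos : ∀ w ≠ 0, 0 < N w := fun w hw => (apply_nonneg N w).lt_of_ne' (mt (hN0 w) hw)
  have himage : (fun q : ℝ × E => (q.1 / N q.2) • q.2) '' (Set.Ioo a b ×ˢ {0}ᶜ) =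
      seminormShell N a b := by
    ext w
    constructor
    · rintro ⟨⟨r, y⟩, ⟨hr, hy⟩, rfl⟩
      have hr0 : 0 < r := ha.trans_lt hr.1
      have : N ((r / N y) • y) = r := by
        rw [map_smul_eq_mul, Real.norm_of_nonneg (div_pos hr0 (hpos y hy)).le,
          div_mul_cancel₀ _ (hpos y hy).ne']
      simpa [seminormShell, this] using hr
    · intro hw
      have hw0 : 0 < N w := ha.trans_lt hw.1
      refine ⟨(N w, w), ⟨hw, ?_⟩, by simp [hw0.ne']⟩
      rintro rfl
      simp at hw0
  rw [← himage]
  refine ((isConnected_Ioo hab).prod (isConnected_compl_singleton_of_one_lt_rank hE 0)).image _ ?_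
  exact (continuousOn_fst.div (hN.comp_continuousOn continuousOn_snd)
    fun q hq => (hpos _ hq.2).ne').smul continuousOn_snd

theorem seminorm_eq_or_eq_of_mem_frontier_seminormShell (hN : Continuous N)
    (hp : p ∈ frontier (seminormShell N a b)) : N p = a ∨ N p = b := by
  have hclosed : IsClosed {w | a ≤ N w ∧ N w ≤ b} :=
    (isClosed_le continuous_const hN).inter (isClosed_le hN continuous_const)
  have hsub : seminormShell N a b ⊆ {w | a ≤ N w ∧ N w ≤ b} := fun w hw => ⟨hw.1.le, hw.2.le⟩
  have hmem : a ≤ N p ∧ N p ≤ b := closure_minimal hsub hclosed (frontier_subset_closure hp)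
  rw [(isOpen_seminormShell hN a b).frontier_eq] at hp
  by_contra! hne
  have : p ∈ seminormShell N a b := ⟨hmem.1.lt_of_ne' hne.1, hmem.2.lt_of_ne hne.2⟩
  exact hp.2 this

end Normed

variable {n : ℕ} {D : Set (Cn n)} {N : Seminorm ℝ (Cn n)} {p : Cn n} {a b r : ℝ}

theorem lipschitzBoundaryNear_of_eventually_lt (hN : Continuous N) (hp : 0 < N p)
    (hD : ∀ᶠ w in 𝓝 p, w ∈ D ↔ N w < r) : LipschitzBoundaryNear D p := by
  obtain ⟨F, e, κ, L, hF, hκ, he, hL, hFN⟩ := exists_isIncreasingAlong_eventually_eq hN hp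
  refine hF.lipschitzBoundaryNear (r := r) hκ he hL ?_
  filter_upwards [hD, hFN] with w hw heq
  rw [hw, heq]

theorem lipschitzBoundaryNear_of_eventually_gt (hN : Continuous N) (hp : 0 < N p)
    (hD : ∀ᶠ w in 𝓝 p, w ∈ D ↔ r < N w) : LipschitzBoundaryNear D p := by
  obtain ⟨F, e, κ, L, hF, hκ, he, hL, hFN⟩ := exists_isIncreasingAlong_eventually_eq hN hp
  refine hF.neg_neg.lipschitzBoundaryNear (r := -r) hκ (by rw [norm_neg, he]) hL.neg ?_
  filter_upwards [hD, hFN] with w hw heq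
  rw [hw, Pi.neg_apply, heq, neg_lt_neg_iff]

theorem lipschitzBoundaryNear_seminormShell (hN : Continuous N) (ha : 0 < a) (hab : a < b)
    (hp : p ∈ frontier (seminormShell N a b)) : LipschitzBoundaryNear (seminormShell N a b) p := by
  rcases seminorm_eq_or_eq_of_mem_frontier_seminormShell hN hp with h | h
  · refine lipschitzBoundaryNear_of_eventually_gt (r := a) hN (ha.trans_eq h.symm) ?_
    filter_upwards [hN.tendsto p |>.eventually_lt_const (h.trans_lt hab)] with w hw
    exact and_iff_left hw
  · refine lipschitzBoundaryNear_of_eventually_lt (r := b) hN ((ha.trans hab).trans_eq h.symm) ?_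
    filter_upwards [hN.tendsto p |>.eventually_const_lt (hab.trans_eq h.symm)] with w hw
    exact and_iff_right hw

end Shell

/-! ### The shell between two `ℓ¹` spheres -/

/-- The `ℓ¹` norm on `ℂⁿ`, as a real seminorm. The domain `shellDomain` is one of its shells. -/
noncomputable def l1Seminorm (n : ℕ) : Seminorm ℝ (Cn n) :=
  Seminorm.of (fun w => ∑ i, ‖w i‖)
    (fun x y => by
      rw [← Finset.sum_add_distrib]
      exact Finset.sum_le_sum fun i _ => norm_add_le (x i) (y i))
    (fun c x => by simp only [PiLp.smul_apply, norm_smul, Finset.mul_sum])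

theorem l1Seminorm_apply {n : ℕ} (w : Cn n) : l1Seminorm n w = ∑ i, ‖w i‖ := rfl

theorem continuous_l1Seminorm (n : ℕ) : Continuous (l1Seminorm n) := by
  change Continuous fun w : Cn n => ∑ i, ‖w i‖
  fun_prop

theorem norm_le_l1Seminorm {n : ℕ} (w : Cn n) : ‖w‖ ≤ l1Seminorm n w := by
  have hw : w = ∑ i, EuclideanSpace.single i (w i) := by
    ext j
    simp [Pi.single_apply]
  calc ‖w‖ = ‖∑ i, EuclideanSpace.single i (w i)‖ := congrArg norm hw
    _ ≤ ∑ i, ‖EuclideanSpace.single i (w i)‖ := norm_sum_le _ _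
    _ = l1Seminorm n w := by simp only [PiLp.norm_single, l1Seminorm_apply]

theorem shellDomain_eq_seminormShell : shellDomain = seminormShell (l1Seminorm 2) 1 2 := by
  simp only [shellDomain, seminormShell, l1Seminorm_apply, Fin.sum_univ_two]

theorem isOpen_shellDomain : IsOpen shellDomain :=
  shellDomain_eq_seminormShell ▸ isOpen_seminormShell (continuous_l1Seminorm 2) 1 2

theorem isBounded_shellDomain : Bornology.IsBounded shellDomain :=
  shellDomain_eq_seminormShell ▸ isBounded_seminormShell norm_le_l1Seminorm 1 2

theorem isConnected_shellDomain : IsConnected shellDomain := by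
  have hrank : 1 < Module.rank ℝ (Cn 2) := by
    rw [← Module.finrank_eq_rank, ← Module.finrank_mul_finrank ℝ ℂ (Cn 2)]
    simp
  have hzero : ∀ w, l1Seminorm 2 w = 0 → w = 0 := fun w hw =>
    norm_le_zero_iff.1 ((norm_le_l1Seminorm w).trans_eq hw)
  rw [shellDomain_eq_seminormShell]
  exact isConnected_seminormShell (continuous_l1Seminorm 2) hzero hrank zero_le_one one_lt_two

theorem lipschitzBoundaryNear_shellDomain {p : Cn 2} (hp : p ∈ frontier shellDomain) :
    LipschitzBoundaryNear shellDomain p := by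
  rw [shellDomain_eq_seminormShell] at hp ⊢
  exact lipschitzBoundaryNear_seminormShell (continuous_l1Seminorm 2) one_pos one_lt_two hp

@[simp] theorem axisPoint_apply_zero (x : ℝ) : axisPoint x 0 = x := by simp [axisPoint]

@[simp] theorem axisPoint_apply_one (x : ℝ) : axisPoint x 1 = 0 := by simp [axisPoint]

theorem axisPoint_add_smul_mem_shellDomain {x : ℝ} (hx : 1 < x) {Y : Cn 2} (hY : ‖Y 0‖ ≤ ‖Y 1‖)
    {s : ℂ} (hs : ‖s‖ * (‖Y 0‖ + ‖Y 1‖) < 2 - x) : axisPoint x + s • Y ∈ shellDomain := by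
  have hnorm : ‖(x : ℂ)‖ = x := Complex.norm_of_nonneg (zero_le_one.trans hx.le)
  have hmul : ‖s‖ * ‖Y 0‖ ≤ ‖s‖ * ‖Y 1‖ := mul_le_mul_of_nonneg_left hY (norm_nonneg s)
  have hupper : ‖(x : ℂ) + s * Y 0‖ ≤ x + ‖s‖ * ‖Y 0‖ := by
    simpa only [hnorm, norm_mul] using norm_add_le (x : ℂ) (s * Y 0)
  have hlower : x - ‖s‖ * ‖Y 0‖ ≤ ‖(x : ℂ) + s * Y 0‖ := by
    simpa only [hnorm, norm_mul] using norm_sub_le_norm_add (x : ℂ) (s * Y 0)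
  constructor <;> simp only [PiLp.add_apply, PiLp.smul_apply, axisPoint_apply_zero,
    axisPoint_apply_one, smul_eq_mul, zero_add, norm_mul] <;> linarith

theorem axisPoint_mem_shellDomain {x : ℝ} (hx : 1 < x) (hx2 : x < 2) :
    axisPoint x ∈ shellDomain := by
  simpa using axisPoint_add_smul_mem_shellDomain hx (le_refl ‖(0 : Cn 2) 0‖) (s := 0)
    (by simpa using hx2)

theorem hasSurroundingDiscs_shellDomain {x R : ℝ} {X : Cn 2} (hx : 1 < x)
    (hR : 4 * ‖X‖ * R < 2 - x) :
    HasSurroundingDiscs shellDomain (axisPoint x) X R := by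
  have hX0 := PiLp.norm_apply_le X 0
  have hX1 := PiLp.norm_apply_le X 1
  have hdisc : ∀ Y : Cn 2, ‖Y 0‖ ≤ ‖Y 1‖ → ‖Y 0‖ + ‖Y 1‖ ≤ 4 * ‖X‖ → ∀ s : ℂ, ‖s‖ < R →
      axisPoint x + s • Y ∈ shellDomain := fun Y hY hYX s hs =>
    axisPoint_add_smul_mem_shellDomain hx hY <| by
      have hR0 : 0 ≤ R := (norm_nonneg s).trans hs.le
      calc ‖s‖ * (‖Y 0‖ + ‖Y 1‖) ≤ R * (4 * ‖X‖) := by gcongr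
        _ < 2 - x := by rwa [mul_comm]
  rcases le_or_gt ‖X 0‖ ‖X 1‖ with h | h
  · refine ⟨0, fun w _ => ?_⟩
    rw [smul_zero, add_zero]
    exact hdisc X h (by linarith [norm_nonneg X])
  · -- Adding `2 ‖X₀‖` in modulus to the second coordinate makes it dominate the first.
    refine ⟨EuclideanSpace.single 1 (2 * ‖X 0‖ : ℂ), fun w hw => ?_⟩
    set Y : Cn 2 := X + w • EuclideanSpace.single 1 (2 * ‖X 0‖ : ℂ) with hYdef
    have hY0 : Y 0 = X 0 := by simp [hYdef]
    have hY1 : Y 1 = X 1 + w * (2 * ‖X 0‖) := by simp [hYdef]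
    have hshift : ‖w * (2 * ‖X 0‖ : ℂ)‖ = 2 * ‖X 0‖ := by simp [hw]
    have hupper : ‖Y 1‖ ≤ ‖X 1‖ + 2 * ‖X 0‖ := hY1 ▸ hshift ▸ norm_add_le _ _
    have hlower : 2 * ‖X 0‖ ≤ ‖Y 1‖ + ‖X 1‖ := by
      rw [hY1, ← hshift, add_comm (X 1)]
      simpa using norm_sub_le (w * (2 * ‖X 0‖ : ℂ) + X 1) (X 1)
    exact hdisc Y (by rw [hY0]; linarith) (by rw [hY0]; linarith)

theorem tendsto_axisPoint_nhdsWithin :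
    Tendsto axisPoint (𝓝[>] 1) (𝓝[shellDomain] (axisPoint 1)) := by
  have hcont : Continuous axisPoint := by
    unfold axisPoint
    fun_prop
  refine tendsto_nhdsWithin_iff.2 ⟨(hcont.tendsto 1).mono_left nhdsWithin_le_nhds, ?_⟩
  filter_upwards [Ioo_mem_nhdsGT one_lt_two] with x hx
  exact axisPoint_mem_shellDomain hx.1 hx.2

theorem axisPoint_one_mem_frontier : axisPoint 1 ∈ frontier shellDomain := by
  have hlim := tendsto_nhdsWithin_iff.1 tendsto_axisPoint_nhdsWithin
  rw [isOpen_shellDomain.frontier_eq]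
  refine ⟨mem_closure_of_tendsto hlim.1 hlim.2, fun h => ?_⟩
  simpa using h.1

theorem eventually_hasSurroundingDiscs_shellDomain {r R : ℝ} (hR : 0 < R) (h : 4 * r * R < 1) :
    ∀ᶠ x : ℝ in 𝓝[>] 1, shellDomain ∈ 𝓝 (axisPoint x) ∧
      ∀ X : Cn 2, ‖X‖ ≤ r → HasSurroundingDiscs shellDomain (axisPoint x) X R := by
  filter_upwards [Ioo_mem_nhdsGT one_lt_two,
    Ioo_mem_nhdsGT (show 1 < 2 - 4 * r * R by linarith)] with x hx hxR
  refine ⟨isOpen_shellDomain.mem_nhds (axisPoint_mem_shellDomain hx.1 hx.2), fun X hX =>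
    hasSurroundingDiscs_shellDomain hx.1 ?_⟩
  calc 4 * ‖X‖ * R ≤ 4 * r * R := by gcongr
    _ < 2 - x := by linarith [hxR.2]

theorem eventually_azukawa_shellDomain_le :
    ∀ᶠ x : ℝ in 𝓝[>] 1, ∀ X : Cn 2, ‖X‖ = 1 → azukawa shellDomain (axisPoint x) X ≤ 8 := by
  filter_upwards [eventually_hasSurroundingDiscs_shellDomain (r := 1) (R := 1 / 8)
    (by norm_num) (by norm_num)] with x ⟨hD, hdiscs⟩ X hX
  simpa using (hdiscs X hX.le).azukawa_le hD (by norm_num)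

theorem eventually_volume_ball_le_volAzukawa :
    ∀ᶠ x : ℝ in 𝓝[>] 1,
      volume (ball (0 : Cn 2) (1 / 9)) ≤ volAzukawa shellDomain (axisPoint x) := by
  filter_upwards [eventually_hasSurroundingDiscs_shellDomain (r := 1 / 9) (R := 2)
    two_pos (by norm_num)] with x ⟨hD, hdiscs⟩
  exact measure_mono fun X hX => (hdiscs X (mem_ball_zero_iff.1 hX).le).azukawa_lt_one hD one_lt_two

theorem eventually_volume_ball_le_volSibony :
    ∀ᶠ x : ℝ in 𝓝[>] 1,
      volume (ball (0 : Cn 2) (1 / 9)) ≤ volSibony shellDomain (axisPoint x) := by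
  filter_upwards [eventually_hasSurroundingDiscs_shellDomain (r := 1 / 9) (R := 2)
    two_pos (by norm_num)] with x ⟨hD, hdiscs⟩
  exact measure_mono fun X hX => (hdiscs X (mem_ball_zero_iff.1 hX).le).sibony_lt_one hD one_lt_two

theorem not_tendsto_zero_of_eventually_le {V : Cn 2 → ℝ≥0∞} {c : ℝ≥0∞} (hc : 0 < c)
    (h : ∀ᶠ x : ℝ in 𝓝[>] 1, c ≤ V (axisPoint x)) :
    ¬ Tendsto V (𝓝[shellDomain] (axisPoint 1)) (𝓝 0) := fun ht =>
  hc.not_ge (ge_of_tendsto (ht.comp tendsto_axisPoint_nhdsWithin) h)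

theorem mainTheorem6 :
    -- `D` is a bounded domain with Lipschitz boundary, and `(1, 0)` is a boundary point
    (IsOpen shellDomain ∧ IsConnected shellDomain ∧ Bornology.IsBounded shellDomain ∧
      (∀ p ∈ frontier shellDomain, LipschitzBoundaryNear shellDomain p) ∧
      axisPoint 1 ∈ frontier shellDomain) ∧
    -- the Azukawa metric at `(x, 0)` stays bounded as `x → 1⁺`, uniformly in unit vectors
    (∃ C : ℝ≥0, ∀ᶠ x : ℝ in 𝓝[>] 1, ∀ X : Cn 2, ‖X‖ = 1 →
      azukawa shellDomain (axisPoint x) X ≤ (C : ℝ≥0∞)) ∧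
    -- the volumes of the indicatrices stay away from zero
    0 < liminf (fun x : ℝ => volAzukawa shellDomain (axisPoint x)) (𝓝[>] 1) ∧
    -- neither indicatrix volume tends to zero at the Lipschitz boundary point `(1, 0)`
    ¬ Tendsto (volAzukawa shellDomain) (𝓝[shellDomain] (axisPoint 1)) (𝓝 0) ∧
    ¬ Tendsto (volSibony shellDomain) (𝓝[shellDomain] (axisPoint 1)) (𝓝 0) := by
  have hball : 0 < volume (ball (0 : Cn 2) (1 / 9)) := measure_ball_pos volume 0 (by norm_num)
  exact ⟨⟨isOpen_shellDomain, isConnected_shellDomain, isBounded_shellDomain,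
      fun _ hp => lipschitzBoundaryNear_shellDomain hp, axisPoint_one_mem_frontier⟩,
    ⟨8, eventually_azukawa_shellDomain_le⟩,
    hball.trans_le (le_liminf_of_le (h := eventually_volume_ball_le_volAzukawa)),
    not_tendsto_zero_of_eventually_le hball eventually_volume_ball_le_volAzukawa,
    not_tendsto_zero_of_eventually_le hball eventually_volume_ball_le_volSibony⟩
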